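/- **Setting.** Let $\mathcal G$ be a set of real functions on a set $\Omega$ that contains the constants and separates points, and equip $\Omega$ with the coarsest topology $\tau(\mathcal G)$ for which all $g\in\mathcal G$ are continuous; assume that $\Omega$ is separable. Let $p\colon\Omega\to[0,\infty)$ belong to the complete lattice cone generated by $\mathcal G$ (the smallest set of functions $\Omega\to(-\infty,\infty]$ that contains $\mathcal G$, is a convex cone and is stable under suprema of arbitrary non-empty families), let all sublevel sets $\{p\le c\}$ be compact, and let every $g\in\mathcal G$ satisfy $|g|\le C_g\,(p+1)$ for some constant $C_g$. Put $\|h\|_\infty=\sup_\Omega|h|$ and $\|g\|_{p+1}=\sup_\Omega |g|/(p+1)$. Let $\mathcal F$ be the lattice cone generated by $\mathcal G$. Let $\mu,\nu$ be Radon probability measures on $\Omega$ with $\int p\,d\mu<\infty$ and $\int p\,d\nu<\infty$. The space $\Omega\times\Omega$ carries the product $\mathcal B(\Omega)\otimes\mathcal B(\Omega)$ of the Borel $\sigma$-algebras (this is the Borel $\sigma$-algebra of $\Omega\times\Omega$ if the compact sets $\{p\le c\}$ are metrizable). For $\delta\ge 0$ a *$\delta$-approximating $\mathcal F$-transport* between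 $\mu$ and $\nu$ is a Radon probability measure $\pi$ on $\Omega\times\Omega$ with marginals $\mu$ and $\nu$ such that for all $g\in\mathcal G$ and all bounded, non-negative, measurable $h$ $$\int_\Omega g(\omega_1)h(\omega_1)\,d\mu(\omega_1)-\int_{\Omega\times\Omega}g(\omega_2)h(\omega_1)\,d\pi(\omega_1,\omega_2)\le\delta\,\|h\|_\infty\,\|g\|_{p+1}.$$ Let $\Gamma_{\mathcal F,\delta}(\mu,\nu)$ be the set of all of them, and $\Lambda_{\mathcal F,\delta}(\mu,\nu)$ the set of all their disintegrations $\lambda(\omega,\cdot)$ with respect to the first co-ordinate, where each $\lambda(\omega,\cdot)$ is a Radon probability measure. A $\lambda\in\Lambda_{\mathcal F,\delta}(\mu,\nu)$ is *maximal* if for every $\lambda'\in\Lambda_{\mathcal F,\delta}(\mu,\nu)$ one has $\operatorname{supp}\lambda'(\omega,\cdot)\subset\operatorname{supp}\lambda(\omega,\cdot)$ for $\mu$-almost every $\omega$. **Theorem.** Let $\delta>0$ and suppose that $\Lambda_{\mathcal F,\varepsilon}(\mu,\nu)\neq\emptyset$ for some $\varepsilon\in[0,\delta)$ (for instance for $\varepsilon=0$,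 that is, there is a disintegration of an $\mathcal F$-transport between $\mu$ and $\nu$). Then: 1. A maximal $\lambda\in\Lambda_{\mathcal F,\delta}(\mu,\nu)$ exists, and every maximal $\lambda\in\Lambda_{\mathcal F,\delta}(\mu,\nu)$ satisfies $\operatorname{supp}\lambda(\omega,\cdot)=\operatorname{supp}\nu$ for $\mu$-almost every $\omega\in\Omega$. 2. A set $U\in\mathcal B(\Omega)\otimes\mathcal B(\Omega)$ satisfies $\pi(U)=0$ for all $\pi\in\Gamma_{\mathcal F,\delta}(\mu,\nu)$ if and only if there are Borel sets $N_1,N_2\subset\Omega$ with $\mu(N_1)=0$, $\nu(N_2)=0$ and $U\subset(N_1\times\Omega)\cup(\Omega\times N_2)$. 3. There is no nontrivial paving: for every family $(C(\omega))_{\omega\in\Omega}$ of subsets of $\Omega$, every $\lambda\in\Lambda_{\mathcal F,\delta}(\mu,\nu)$ satisfies $\operatorname{supp}\lambda(\omega,\cdot)\subset C(\omega)$ for $\mu$-almost every $\omega$ if and only if $\operatorname{supp}\nu\subset C(\omega)$ for $\mu$-almost every $\omega$. -/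

import Mathlib

open MeasureTheory ProbabilityTheory Set

namespace ApproxTransport

/-- A complete lattice cone of functions with values in `(-∞, ∞]`: a convex cone that is stable
under suprema of arbitrary (non-empty) families. -/
structure IsCompleteLatticeCone {Ω : Type*} (K : Set (Ω → EReal)) : Prop where
  ne_bot : ∀ f ∈ K, ∀ ω, f ω ≠ ⊥
  cone : ∀ f ∈ K, ∀ g ∈ K, ∀ α β : ℝ, 0 ≤ α → 0 ≤ β →
    (fun ω => (α : EReal) * f ω + (β : EReal) * g ω) ∈ K
  sup : ∀ S : Set (Ω → EReal), S ⊆ K → S.Nonempty → (fun ω => ⨆ f ∈ S, f ω) ∈ K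

/-- The complete lattice cone generated by a set `G` of real functions (equivalently, by the
lattice cone generated by `G`): the smallest complete lattice cone containing `G`. -/
def completeLatticeCone {Ω : Type*} (G : Set (Ω → ℝ)) : Set (Ω → EReal) :=
  {f | ∀ K : Set (Ω → EReal), IsCompleteLatticeCone K →
    (∀ g ∈ G, (fun ω => (g ω : EReal)) ∈ K) → f ∈ K}

/-- The standing assumptions on the generating set `G`, the topology `τ(G)` of `Ω` and the
weight `p`. -/
structure StandingAssumption {Ω : Type*} [TopologicalSpace Ω] (G : Set (Ω → ℝ)) (p : Ω → ℝ) :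
    Prop where
  /-- The topology is the coarsest one for which all the functions in `G` are continuous. -/
  topology_eq : (inferInstance : TopologicalSpace Ω) =
    ⨅ g ∈ G, TopologicalSpace.induced g inferInstance
  separable : TopologicalSpace.SeparableSpace Ω
  const_mem : ∀ c : ℝ, (fun _ => c) ∈ G
  separates : ∀ x y : Ω, x ≠ y → ∃ g ∈ G, g x ≠ g y
  p_nonneg : ∀ ω, 0 ≤ p ω
  p_mem : (fun ω => (p ω : EReal)) ∈ completeLatticeCone G
  /-- `p` is proper: its sublevel sets are compact. -/
  p_proper : ∀ c : ℝ, IsCompact {ω | p ω ≤ c}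
  growth : ∀ g ∈ G, ∃ C : ℝ, 0 < C ∧ ∀ ω, |g ω| ≤ C * (p ω + 1)

/-- The norm `sup |a| / w` of a function `a` of `w`-growth. -/
noncomputable def growthNorm {Ω : Type*} (w a : Ω → ℝ) : ℝ := ⨆ ω, |a ω| / w ω

/-- Radon measures: every measurable set is approximated from inside by compact sets. -/
def IsRadon {X : Type*} [TopologicalSpace X] [MeasurableSpace X] (m : Measure X) : Prop :=
  ∀ B : Set X, MeasurableSet B → ∀ ε : ENNReal, 0 < ε → ∃ K ⊆ B, IsCompact K ∧ m (B \ K) < ε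

section

variable {Ω : Type*} [TopologicalSpace Ω] [MeasurableSpace Ω]

/-- The `δ`-approximating transports between `μ` and `ν` (for the lattice cone generated
by `G`). -/
def approxTransports (G : Set (Ω → ℝ)) (p : Ω → ℝ) (δ : ℝ) (μ ν : Measure Ω) :
    Set (Measure (Ω × Ω)) :=
  {π | IsProbabilityMeasure π ∧ IsRadon π ∧ π.map Prod.fst = μ ∧ π.map Prod.snd = ν ∧
    ∀ g ∈ G, ∀ h : Ω → ℝ, Measurable h → (∀ ω, 0 ≤ h ω) → (∃ M, ∀ ω, h ω ≤ M) →
      (∫ ω, g ω * h ω ∂μ) - (∫ z, g z.2 * h z.1 ∂π)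
        ≤ δ * growthNorm (fun _ => 1) h * growthNorm (fun ω => p ω + 1) g}

/-- `κ` is a disintegration of `π` with respect to the first co-ordinate, whose law is `μ`. -/
structure IsDisintegration (μ : Measure Ω) (π : Measure (Ω × Ω)) (κ : Kernel Ω Ω) : Prop where
  isProbabilityMeasure : ∀ ω, IsProbabilityMeasure (κ ω)
  isRadon : ∀ ω, IsRadon (κ ω)
  disintegrates : ∀ B : Set (Ω × Ω), MeasurableSet B → ∀ E : Set Ω, MeasurableSet E →
    π (B ∩ Prod.fst ⁻¹' E) = ∫⁻ ω in E, κ ω {ω' | (ω, ω') ∈ B} ∂μ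

/-- The disintegrations of all `δ`-approximating transports between `μ` and `ν`. -/
def approxDisintegrations (G : Set (Ω → ℝ)) (p : Ω → ℝ) (δ : ℝ) (μ ν : Measure Ω) :
    Set (Kernel Ω Ω) :=
  {κ | ∃ π ∈ approxTransports G p δ μ ν, IsDisintegration μ π κ}

/-- Maximal disintegrations: those with the largest supports, up to `μ`-null sets. -/
def IsMaximalDisintegration (G : Set (Ω → ℝ)) (p : Ω → ℝ) (δ : ℝ) (μ ν : Measure Ω)
    (κ : Kernel Ω Ω) : Prop :=
  κ ∈ approxDisintegrations G p δ μ ν ∧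
    ∀ κ' ∈ approxDisintegrations G p δ μ ν, ∀ᵐ ω ∂μ, (κ' ω).support ⊆ (κ ω).support

end

/-- `U` is polar with respect to a set `Γ` of measures. -/
def IsPolar {X : Type*} [MeasurableSpace X] (Γ : Set (Measure X)) (U : Set X) : Prop :=
  ∀ π ∈ Γ, π U = 0

end ApproxTransport

/-! The strict inequality `ε < δ` leaves room to perturb. For any coupling of `μ` and `ν`, the
defect in the transport inequality is at most a fixed multiple of `‖h‖‖g‖`, because `p` is
integrable for both marginals. Hence an `ε`-approximating transport mixed with a small weight `b` of
an arbitrary coupling is `δ`-approximating (`exists_mixture_mem_approxTransports`).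

Mixing with `μ.prod ν` gives a disintegration dominating `b • ν` at every point, so its supports
contain `ν.support`. The second marginal forces the reverse inclusion almost everywhere for every
disintegration. This settles maximality and pavings.

For polar sets, mixing shows that a polar set is null for all couplings. It remains to prove a
Kellerer-type theorem (`exists_null_cover_of_forall_coupling`): such a set lies in two null strips.
The cost of covering by strips is continuous along increasing sequences, so Choquet's argument finds
a compact subset of positive cost inside any measurable set of positive cost. On a compact set,
Hahn-Banach and Riesz produce a nonzero measure with marginals below `μ` and `ν`, and this measure
extends to a coupling charging the set. -/

namespace ApproxTransport

/-! ### Covering by strips, and continuity of its cost along increasing sequences. -/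

section CoverCost

variable {X Y : Type*} [MeasurableSpace X] [MeasurableSpace Y]

/-- The smallest cost `μ A + ν B` of covering `U` by two strips `A × Y` and `X × B`. -/
noncomputable def coverCost (μ : Measure X) (ν : Measure Y) (U : Set (X × Y)) : ENNReal :=
  ⨅ (A : Set X) (B : Set Y) (_ : MeasurableSet A ∧ MeasurableSet B ∧
    U ⊆ (A ×ˢ univ) ∪ (univ ×ˢ B)), μ A + ν B

variable {μ : Measure X} {ν : Measure Y}

lemma coverCost_le {U : Set (X × Y)} {A : Set X} {B : Set Y} (hA : MeasurableSet A)
    (hB : MeasurableSet B) (h : U ⊆ (A ×ˢ univ) ∪ (univ ×ˢ B)) :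
    coverCost μ ν U ≤ μ A + ν B :=
  iInf₂_le_of_le A B (iInf_le_of_le ⟨hA, hB, h⟩ le_rfl)

lemma exists_cover_of_coverCost_lt {U : Set (X × Y)} {a : ENNReal} (h : coverCost μ ν U < a) :
    ∃ A B, MeasurableSet A ∧ MeasurableSet B ∧ U ⊆ (A ×ˢ univ) ∪ (univ ×ˢ B) ∧ μ A + ν B < a := by
  simp only [coverCost, iInf_lt_iff] at h
  obtain ⟨A, B, ⟨hA, hB, h⟩, h'⟩ := h
  exact ⟨A, B, hA, hB, h, h'⟩

lemma coverCost_ne_top [IsFiniteMeasure μ] [IsFiniteMeasure ν] (U : Set (X × Y)) :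
    coverCost μ ν U ≠ ⊤ := by
  have : coverCost μ ν U ≤ μ univ + ν univ :=
    coverCost_le MeasurableSet.univ MeasurableSet.univ (by simp)
  exact ne_top_of_le_ne_top (by finiteness) this

/-- Covers form a lattice on which the cost is modular. If `(A, B)` and `(P, Q)` both cover `U m`,
so does `(A ∩ P, B ∪ Q)`, which costs at least `coverCost μ ν (U m)`. Thus passing to `(A ∪ P, B ∩
Q)` only adds the error `e m` to the cost of `(P, Q)`. -/
lemma measure_iUnion_add_iInter_le [IsFiniteMeasure μ] [IsFiniteMeasure ν]
    {U : ℕ → Set (X × Y)} (hU : Monotone U)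
    {a : ENNReal} (ha : ∀ n, coverCost μ ν (U n) ≤ a) {e : ℕ → ENNReal}
    {A : ℕ → Set X} {B : ℕ → Set Y} (hA : ∀ n, MeasurableSet (A n)) (hB : ∀ n, MeasurableSet (B n))
    (hc : ∀ n, U n ⊆ (A n ×ˢ univ) ∪ (univ ×ˢ B n))
    (he : ∀ n, μ (A n) + ν (B n) ≤ coverCost μ ν (U n) + e n) (j m : ℕ) :
    μ (⋃ i ≤ j, A (m + i)) + ν (⋂ i ≤ j, B (m + i)) ≤ a + ∑ i ∈ Finset.range (j + 1), e (m + i) := by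
  induction j generalizing m with
  | zero => simpa using (he m).trans (by gcongr; exact ha m)
  | succ j ih =>
    have h1 := ih (m + 1)
    set P := ⋃ i ≤ j, A (m + 1 + i) with hP
    set Q := ⋂ i ≤ j, B (m + 1 + i) with hQ
    have hPm : MeasurableSet P := .biUnion (to_countable _) fun i _ => hA _
    have hQm : MeasurableSet Q := .biInter (to_countable _) fun i _ => hB _
    have e1 : ⋃ i ≤ j + 1, A (m + i) = A m ∪ P := by
      ext x
      simp only [hP, mem_iUnion, mem_union, exists_prop]
      constructor
      · rintro ⟨i, hi, h⟩
        rcases i with _ | i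
        · exact Or.inl h
        · exact Or.inr ⟨i, by omega, by rwa [add_assoc, add_comm 1]⟩
      · rintro (h | ⟨i, hi, h⟩)
        · exact ⟨0, by omega, h⟩
        · exact ⟨i + 1, by omega, by rwa [add_assoc, add_comm 1] at h⟩
    have e2 : ⋂ i ≤ j + 1, B (m + i) = B m ∩ Q := by
      ext x
      simp only [hQ, mem_iInter, mem_inter_iff]
      constructor
      · intro h
        exact ⟨h 0 (by omega), fun i hi => by
          have := h (i + 1) (by omega); rwa [add_assoc, add_comm 1]⟩
      · rintro ⟨h0, h⟩ i hi
        rcases i with _ | i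
        · exact h0
        · have := h i (by omega); rwa [add_assoc, add_comm 1] at this
    have hcP : U m ⊆ (P ×ˢ univ) ∪ (univ ×ˢ Q) := by
      rintro ⟨x, y⟩ hxy
      by_cases hx : x ∈ P
      · exact Or.inl ⟨hx, mem_univ _⟩
      · refine Or.inr ⟨mem_univ _, ?_⟩
        simp only [hP, hQ, mem_iUnion, mem_iInter, not_exists] at hx ⊢
        intro i hi
        rcases hc (m + 1 + i) (hU (by omega) hxy) with h | h
        · exact absurd h.1 (hx i hi)
        · exact h.2
    have h2 : coverCost μ ν (U m) ≤ μ (A m ∩ P) + ν (B m ∪ Q) := by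
      refine coverCost_le ((hA m).inter hPm) ((hB m).union hQm) ?_
      rintro ⟨x, y⟩ hxy
      have h3 := hc m hxy
      have h4 := hcP hxy
      simp only [mem_union, mem_prod, mem_univ, and_true, true_and, mem_inter_iff] at h3 h4 ⊢
      tauto
    have h5 : (μ (A m ∪ P) + ν (B m ∩ Q)) + (μ (A m ∩ P) + ν (B m ∪ Q)) =
        (μ (A m) + ν (B m)) + (μ P + ν Q) := by
      have k1 := measure_union_add_inter (μ := μ) (A m) hPm
      have k2 := measure_union_add_inter (μ := ν) (B m) hQm
      rw [show (μ (A m ∪ P) + ν (B m ∩ Q)) + (μ (A m ∩ P) + ν (B m ∪ Q)) =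
        (μ (A m ∪ P) + μ (A m ∩ P)) + (ν (B m ∪ Q) + ν (B m ∩ Q)) by ring, k1, k2]
      ring
    rw [e1, e2]
    refine ENNReal.le_of_add_le_add_left (coverCost_ne_top (μ := μ) (ν := ν) (U m)) ?_
    calc coverCost μ ν (U m) + (μ (A m ∪ P) + ν (B m ∩ Q))
        ≤ (μ (A m ∪ P) + ν (B m ∩ Q)) + (μ (A m ∩ P) + ν (B m ∪ Q)) := by
          rw [add_comm]; gcongr
      _ = (μ (A m) + ν (B m)) + (μ P + ν Q) := h5
      _ ≤ (coverCost μ ν (U m) + e m) + (a + ∑ i ∈ Finset.range (j + 1), e (m + 1 + i)) := by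
          exact add_le_add (he m) h1
      _ = coverCost μ ν (U m) + (a + ∑ i ∈ Finset.range (j + 1 + 1), e (m + i)) := by
          rw [Finset.sum_range_succ' _ (j + 1)]
          simp only [add_zero, add_assoc, add_comm 1]
          ring

/-- Near-optimal covers with summable errors are combined into the limsup of the `A n` and the
liminf of the `B n`: if `x` is eventually outside `A n`, then `y` is eventually in `B n`. For a
constant sequence this says that the infimum is attained. -/
lemma exists_cover_iUnion [IsFiniteMeasure μ] [IsFiniteMeasure ν] {U : ℕ → Set (X × Y)}
    (hU : Monotone U) {a : ENNReal} (ha : ∀ n, coverCost μ ν (U n) ≤ a) :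
    ∃ A B, MeasurableSet A ∧ MeasurableSet B ∧ (⋃ n, U n) ⊆ (A ×ˢ univ) ∪ (univ ×ˢ B) ∧
      μ A + ν B ≤ a := by
  obtain ⟨e, he0, hes⟩ := ENNReal.exists_pos_sum_of_countable' (one_ne_zero) ℕ
  have hex : ∀ n, ∃ A B, MeasurableSet A ∧ MeasurableSet B ∧
      U n ⊆ (A ×ˢ univ) ∪ (univ ×ˢ B) ∧ μ A + ν B < coverCost μ ν (U n) + e n := fun n =>
    exists_cover_of_coverCost_lt (ENNReal.lt_add_right (coverCost_ne_top _) (he0 n).ne')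
  choose A B hA hB hc hlt using hex
  have key := measure_iUnion_add_iInter_le hU ha hA hB hc (fun n => (hlt n).le)
  have htail : ∀ m, μ (⋃ i, A (m + i)) + ν (⋂ i, B (m + i)) ≤ a + ∑' i, e (m + i) := by
    intro m
    have hlim : Filter.Tendsto (fun j => μ (⋃ i ≤ j, A (m + i))) Filter.atTop
        (nhds (μ (⋃ i, A (m + i)))) := tendsto_measure_iUnion_accumulate
    refine le_of_tendsto (hlim.add_const _) (Filter.Eventually.of_forall fun j => ?_)
    refine le_trans ?_ ((key j m).trans ?_)
    · exact add_le_add le_rfl (measure_mono (subset_iInter₂ fun i _ => iInter_subset _ i))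
    · gcongr
      exact ENNReal.sum_le_tsum _
  have hAm : ∀ m, MeasurableSet (⋃ i, A (m + i)) := fun m => .iUnion fun _ => hA _
  have hBm : ∀ m, MeasurableSet (⋂ i, B (m + i)) := fun m => .iInter fun _ => hB _
  have hmono : Monotone fun m => ⋂ i, B (m + i) := by
    intro m l hml y hy
    simp only [mem_iInter] at hy ⊢
    intro i
    have := hy (l - m + i)
    rwa [show m + (l - m + i) = l + i by omega] at this
  have htend : Filter.Tendsto (fun m => a + ∑' i, e (m + i)) Filter.atTop (nhds a) := by
    have := ENNReal.tendsto_sum_nat_add e (ne_top_of_lt hes)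
    simpa [add_comm] using this.const_add a
  refine ⟨⋂ m, ⋃ i, A (m + i), ⋃ m, ⋂ i, B (m + i), .iInter hAm, .iUnion hBm, ?_, ?_⟩
  · rintro ⟨x, y⟩ hxy
    obtain ⟨n, hn⟩ := mem_iUnion.1 hxy
    by_cases hx : x ∈ ⋂ m, ⋃ i, A (m + i)
    · exact Or.inl ⟨hx, mem_univ _⟩
    · refine Or.inr ⟨mem_univ _, ?_⟩
      simp only [mem_iInter, mem_iUnion, not_forall, not_exists] at hx ⊢
      obtain ⟨m, hm⟩ := hx
      refine ⟨n + m, fun i => ?_⟩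
      rcases hc (n + m + i) (hU (by omega) hn) with h | h
      · exact absurd h.1 (by have := hm (n + i); rwa [show m + (n + i) = n + m + i by omega] at this)
      · exact h.2
  · have hlim : Filter.Tendsto (fun m => ν (⋂ i, B (m + i))) Filter.atTop
        (nhds (ν (⋃ m, ⋂ i, B (m + i)))) := tendsto_measure_iUnion_atTop hmono
    refine le_of_tendsto_of_tendsto (hlim.const_add _) htend
      (Filter.Eventually.of_forall fun m => ?_)
    refine le_trans ?_ (htail m)
    exact add_le_add (measure_mono (iInter_subset _ m)) le_rfl

lemma exists_lt_coverCost_of_iUnion [IsFiniteMeasure μ] [IsFiniteMeasure ν]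
    {U : ℕ → Set (X × Y)} (hU : Monotone U) {a : ENNReal} (ha : a < coverCost μ ν (⋃ n, U n)) :
    ∃ n, a < coverCost μ ν (U n) := by
  by_contra! h
  obtain ⟨A, B, hA, hB, hc, hle⟩ := exists_cover_iUnion hU h
  exact absurd ((coverCost_le hA hB hc).trans hle) ha.not_ge

lemma exists_null_cover [IsFiniteMeasure μ] [IsFiniteMeasure ν] {U : Set (X × Y)}
    (h : coverCost μ ν U = 0) :
    ∃ A B, MeasurableSet A ∧ MeasurableSet B ∧ μ A = 0 ∧ ν B = 0 ∧
      U ⊆ (A ×ˢ univ) ∪ (univ ×ˢ B) := by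
  obtain ⟨A, B, hA, hB, hc, hle⟩ := exists_cover_iUnion (μ := μ) (ν := ν)
    (U := fun _ => U) (a := 0) monotone_const (fun _ => h.le)
  have := nonpos_iff_eq_zero.1 hle
  rw [add_eq_zero] at this
  exact ⟨A, B, hA, hB, this.1, this.2, by simpa using hc⟩

lemma coverCost_le_inter_prod {U : Set (X × Y)} {K : Set X} {L : Set Y} (hK : MeasurableSet K)
    (hL : MeasurableSet L) :
    coverCost μ ν U ≤ coverCost μ ν (U ∩ K ×ˢ L) + (μ Kᶜ + ν Lᶜ) := by
  refine ENNReal.le_of_forall_pos_le_add fun r hr hfin => ?_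
  have hne : coverCost μ ν (U ∩ K ×ˢ L) ≠ ⊤ := fun h => by simp [h] at hfin
  obtain ⟨A, B, hA, hB, hc, hlt⟩ := exists_cover_of_coverCost_lt
    (ENNReal.lt_add_right hne (ENNReal.coe_pos.2 hr).ne')
  have : coverCost μ ν U ≤ μ (A ∪ Kᶜ) + ν (B ∪ Lᶜ) := by
    refine coverCost_le (hA.union hK.compl) (hB.union hL.compl) ?_
    rintro ⟨x, y⟩ hxy
    by_cases hx : x ∈ K
    · by_cases hy : y ∈ L
      · rcases hc ⟨hxy, hx, hy⟩ with h | h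
        · exact Or.inl ⟨Or.inl h.1, mem_univ _⟩
        · exact Or.inr ⟨mem_univ _, Or.inl h.2⟩
      · exact Or.inr ⟨mem_univ _, Or.inr hy⟩
    · exact Or.inl ⟨Or.inr hx, mem_univ _⟩
  calc coverCost μ ν U ≤ μ (A ∪ Kᶜ) + ν (B ∪ Lᶜ) := this
    _ ≤ (μ A + μ Kᶜ) + (ν B + ν Lᶜ) := by gcongr <;> exact measure_union_le _ _
    _ = (μ A + ν B) + (μ Kᶜ + ν Lᶜ) := by ring
    _ ≤ (coverCost μ ν (U ∩ K ×ˢ L) + r) + (μ Kᶜ + ν Lᶜ) := by gcongr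
    _ = _ := by ring

end CoverCost

/-! ### Regularity of Radon measures. -/

section Radon

variable {X : Type*} [TopologicalSpace X] [MeasurableSpace X]

lemma IsRadon.add {m m' : Measure X} (h : IsRadon m) (h' : IsRadon m') : IsRadon (m + m') := by
  intro B hB ε hε
  have hε2 : 0 < ε / 2 := ENNReal.half_pos hε.ne'
  obtain ⟨K, hKB, hK, hlt⟩ := h B hB (ε / 2) hε2
  obtain ⟨K', hKB', hK', hlt'⟩ := h' B hB (ε / 2) hε2
  refine ⟨K ∪ K', union_subset hKB hKB', hK.union hK', ?_⟩
  rw [Measure.add_apply]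
  calc _ ≤ m (B \ K) + m' (B \ K') := by
        gcongr
        · exact subset_union_left
        · exact subset_union_right
    _ < ε / 2 + ε / 2 := ENNReal.add_lt_add hlt hlt'
    _ = ε := ENNReal.add_halves ε

lemma IsRadon.smul {m : Measure X} (h : IsRadon m) {c : ENNReal} (hc : c ≠ ⊤) :
    IsRadon (c • m) := by
  intro B hB ε hε
  by_cases hc0 : c = 0
  · exact ⟨∅, empty_subset _, isCompact_empty, by simpa [hc0] using hε⟩
  obtain ⟨K, hKB, hK, hlt⟩ := h B hB (ε / c) (ENNReal.div_pos hε.ne' hc)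
  refine ⟨K, hKB, hK, ?_⟩
  rw [Measure.smul_apply, smul_eq_mul, mul_comm]
  exact (ENNReal.lt_div_iff_mul_lt (Or.inl hc0) (Or.inl hc)).1 hlt

lemma IsRadon.exists_isOpen [T2Space X] [OpensMeasurableSpace X] {m : Measure X}
    [IsFiniteMeasure m] (h : IsRadon m) {B : Set X} (hB : MeasurableSet B) {ε : ENNReal}
    (hε : 0 < ε) : ∃ V, B ⊆ V ∧ IsOpen V ∧ m V ≤ m B + ε := by
  obtain ⟨K, hKB, hK, hlt⟩ := h Bᶜ hB.compl ε hε
  refine ⟨Kᶜ, subset_compl_comm.1 hKB, hK.isClosed.isOpen_compl, ?_⟩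
  calc m Kᶜ ≤ m (B ∪ (Bᶜ \ K)) := measure_mono fun x hx => by
        by_cases hxB : x ∈ B
        · exact Or.inl hxB
        · exact Or.inr ⟨hxB, hx⟩
    _ ≤ m B + m (Bᶜ \ K) := measure_union_le _ _
    _ ≤ m B + ε := by gcongr

/-- No countable base is available. Instead, compact sets disjoint from the support are null, and
inner regularity does the rest. -/
lemma IsRadon.measure_compl_support [OpensMeasurableSpace X] {m : Measure X} (h : IsRadon m) :
    m m.supportᶜ = 0 := by
  by_contra hne
  obtain ⟨K, hK, hKc, hlt⟩ := h _ Measure.isOpen_compl_support.measurableSet _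
    (pos_iff_ne_zero.2 hne)
  have h0 : m K = 0 := Measure.measure_eq_zero_of_isCompact_subset_compl_support hKc hK
  have : m m.supportᶜ ≤ m K + m (m.supportᶜ \ K) :=
    (measure_mono fun x hx => by by_cases hxK : x ∈ K <;> simp_all).trans (measure_union_le _ _)
  rw [h0, zero_add] at this
  exact absurd this hlt.not_ge

/-- Lusin's theorem for maps into the Cantor space. -/
lemma IsRadon.exists_continuousOn [T2Space X] [OpensMeasurableSpace X] {m : Measure X}
    (h : IsRadon m) {f : X → ℕ → Bool} (hf : Measurable f) {ε : ENNReal}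
    (hε : 0 < ε) : ∃ K, IsCompact K ∧ ContinuousOn f K ∧ m Kᶜ ≤ ε := by
  obtain ⟨e, he0, hes⟩ := ENNReal.exists_pos_sum_of_countable' (ENNReal.half_pos hε.ne').ne' ℕ
  have hm : ∀ i b, MeasurableSet {x | f x i = b} := fun i b =>
    ((measurable_pi_apply i).comp hf) (measurableSet_singleton b)
  have hex : ∀ i b, ∃ K ⊆ {x | f x i = b}, IsCompact K ∧ m ({x | f x i = b} \ K) < e i :=
    fun i b => h _ (hm i b) _ (he0 i)
  choose K hKs hK hlt using hex
  have hcl : ∀ i, IsClosed (K i true ∪ K i false) := fun i =>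
    ((hK i true).union (hK i false)).isClosed
  -- The `i`-th coordinate of `f` is constant on each of the closed sets `K i true` and `K i false`,
  -- hence continuous on their union.
  refine ⟨⋂ i, K i true ∪ K i false, ?_, ?_, ?_⟩
  · exact ((hK 0 true).union (hK 0 false)).of_isClosed_subset (isClosed_iInter hcl)
      (iInter_subset _ 0)
  · rw [continuousOn_pi]
    intro i
    have hsub : (⋂ i, K i true ∪ K i false) ⊆ K i true ∪ K i false := iInter_subset _ i
    refine ContinuousOn.mono ?_ hsub
    refine ContinuousOn.union_of_isClosed ?_ ?_ (hK i true).isClosed (hK i false).isClosed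
    · exact continuousOn_const.congr fun x hx => hKs i true hx
    · exact continuousOn_const.congr fun x hx => hKs i false hx
  · rw [compl_iInter]
    calc m (⋃ i, (K i true ∪ K i false)ᶜ) ≤ ∑' i, m (K i true ∪ K i false)ᶜ := measure_iUnion_le _
      _ ≤ ∑' i, (e i + e i) := by
          refine ENNReal.tsum_le_tsum fun i => ?_
          calc m (K i true ∪ K i false)ᶜ
              ≤ m (({x | f x i = true} \ K i true) ∪ ({x | f x i = false} \ K i false)) :=
                measure_mono fun x hx => by
                  simp only [mem_compl_iff, mem_union, not_or] at hx
                  cases hfx : f x i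
                  · exact Or.inr ⟨hfx, hx.2⟩
                  · exact Or.inl ⟨hfx, hx.1⟩
            _ ≤ _ := (measure_union_le _ _).trans (add_le_add (hlt _ _).le (hlt _ _).le)
      _ ≤ ε := by
          rw [ENNReal.tsum_add]
          calc _ ≤ ε / 2 + ε / 2 := add_le_add hes.le hes.le
            _ = ε := ENNReal.add_halves ε

end Radon

/-! ### Choquet capacitability for the covering cost. -/

section Capacitability

/-- A measurable subset of a product is the preimage of a Borel set under a product of measurable
maps to the Cantor space. -/
lemma exists_preimage_cantor {X Y : Type*} [MeasurableSpace X] [MeasurableSpace Y]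
    {U : Set (X × Y)} (hU : MeasurableSet U) :
    ∃ (f : X → ℕ → Bool) (g : Y → ℕ → Bool) (V : Set ((ℕ → Bool) × (ℕ → Bool))),
      Measurable f ∧ Measurable g ∧ MeasurableSet V ∧ U = Prod.map f g ⁻¹' V := by
  have hU' := hU
  rw [← generateFrom_prod] at hU'
  induction U, hU' using MeasurableSpace.generateFrom_induction with
  | hC U hmem _ =>
    classical
    obtain ⟨s, hs, t, ht, rfl⟩ := hmem
    refine ⟨fun x _ => decide (x ∈ s), fun y _ => decide (y ∈ t),
      {q | q.1 0 = true ∧ q.2 0 = true}, ?_, ?_, ?_, ?_⟩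
    · exact measurable_pi_lambda _ fun _ => measurable_to_bool (by simpa [preimage] using hs)
    · exact measurable_pi_lambda _ fun _ => measurable_to_bool (by simpa [preimage] using ht)
    · have h1 : Measurable fun q : (ℕ → Bool) × (ℕ → Bool) => q.1 0 :=
        (measurable_pi_apply 0).comp measurable_fst
      have h2 : Measurable fun q : (ℕ → Bool) × (ℕ → Bool) => q.2 0 :=
        (measurable_pi_apply 0).comp measurable_snd
      exact (h1 (measurableSet_singleton true)).inter (h2 (measurableSet_singleton true))
    · ext ⟨x, y⟩
      simp
  | empty =>
    exact ⟨fun _ _ => true, fun _ _ => true, ∅, measurable_const, measurable_const, .empty,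
      by simp⟩
  | compl U _ ih =>
    obtain ⟨f, g, V, hf, hg, hV, h⟩ := ih (by simpa using hU.compl)
    exact ⟨f, g, Vᶜ, hf, hg, hV.compl, by rw [h, preimage_compl]⟩
  | iUnion U hU' ih =>
    replace hU' : ∀ n, MeasurableSet (U n) := fun n => by
      have := hU' n; rwa [generateFrom_prod] at this
    choose f g V hf hg hV h using fun n => ih n (hU' n)
    -- Countably many codes are interleaved into one by the pairing function, and `e n` recovers the
    -- `n`-th.
    let e : ℕ → (ℕ → Bool) → (ℕ → Bool) := fun n q k => q (Nat.pair n k)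
    have he : ∀ n, Measurable (e n) := fun n =>
      measurable_pi_lambda _ fun k => measurable_pi_apply _
    refine ⟨fun x k => f k.unpair.1 x k.unpair.2, fun y k => g k.unpair.1 y k.unpair.2,
      ⋃ n, Prod.map (e n) (e n) ⁻¹' V n, ?_, ?_, ?_, ?_⟩
    · exact measurable_pi_lambda _ fun k => (measurable_pi_apply _).comp (hf _)
    · exact measurable_pi_lambda _ fun k => (measurable_pi_apply _).comp (hg _)
    · exact .iUnion fun n => ((he n).prodMap (he n)) (hV n)
    · ext ⟨x, y⟩
      simp [h, e]

/-- The sequences whose first `k` terms are bounded by those of `n`. -/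
def boundedPrefix (n : ℕ → ℕ) (k : ℕ) : Set (ℕ → ℕ) := {x | ∀ i < k, x i ≤ n i}

lemma isCompact_setOf_le (n : ℕ → ℕ) : IsCompact {x : ℕ → ℕ | ∀ i, x i ≤ n i} := by
  have : {x : ℕ → ℕ | ∀ i, x i ≤ n i} = Set.pi univ fun i => Iic (n i) := by
    ext; simp [Pi.le_def]
  rw [this]
  exact isCompact_univ_pi fun i => (finite_Iic (n i)).isCompact

lemma exists_boundedPrefix_subset (n : ℕ → ℕ) {O : Set (ℕ → ℕ)} (hO : IsOpen O)
    (h : {x : ℕ → ℕ | ∀ i, x i ≤ n i} ⊆ O) : ∃ k, boundedPrefix n k ⊆ O := by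
  have hopen : ∀ k, IsOpen {y : ℕ → ℕ | PiNat.cylinder y k ⊆ O} := fun k => by
    rw [isOpen_iff_forall_mem_open]
    intro y hy
    refine ⟨PiNat.cylinder y k, fun z hz => ?_, PiNat.isOpen_cylinder _ y k,
      PiNat.self_mem_cylinder y k⟩
    rw [mem_ofPred_eq, PiNat.mem_cylinder_iff_eq.1 hz]
    exact hy
  have hcov : {x : ℕ → ℕ | ∀ i, x i ≤ n i} ⊆ ⋃ k, {y : ℕ → ℕ | PiNat.cylinder y k ⊆ O} := by
    intro y hy
    obtain ⟨_, ⟨z, k, rfl⟩, hyk, hk⟩ :=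
      (PiNat.isTopologicalBasis_cylinders (fun _ => ℕ)).exists_subset_of_mem_open (h hy) hO
    refine mem_iUnion.2 ⟨k, ?_⟩
    rw [mem_ofPred_eq, PiNat.mem_cylinder_iff_eq.1 hyk]
    exact hk
  obtain ⟨k, hk⟩ := (isCompact_setOf_le n).elim_directed_cover _ hopen hcov
    (monotone_nat_of_le_succ fun k y hy =>
      (PiNat.cylinder_anti y (Nat.le_succ k)).trans hy).directed_le
  refine ⟨k, fun x hx => ?_⟩
  -- Truncating `x` at `n` lands in the compact set without changing the first `k` terms.
  have hmem : (fun i => min (x i) (n i)) ∈ {x : ℕ → ℕ | ∀ i, x i ≤ n i} :=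
    fun i => min_le_right _ _
  refine hk hmem ?_
  rw [PiNat.mem_cylinder_iff]
  intro i hi
  exact (min_eq_left (hx i hi)).symm

/-- The inductive step of Choquet's capacitability argument, for a monotone set function `c` that
is continuous along increasing sequences. -/
lemma exists_boundedPrefix_lt {c : Set (ℕ → ℕ) → ENNReal}
    (hc : ∀ S : ℕ → Set (ℕ → ℕ), Monotone S → ∀ a, a < c (⋃ n, S n) → ∃ n, a < c (S n))
    {a : ENNReal} (ha : a < c univ) : ∃ n : ℕ → ℕ, ∀ k, a < c (boundedPrefix n k) := by
  -- The hypothesis on `S` sits inside the existential so that `m` becomes a total function, usable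
  -- in the recursion for `T`.
  have step : ∀ (S : Set (ℕ → ℕ)) (k : ℕ), ∃ m, a < c S → a < c (S ∩ {x | x k ≤ m}) := by
    intro S k
    by_cases hS : a < c S
    · have hU : ⋃ m : ℕ, S ∩ {x | x k ≤ m} = S := by
        ext x
        simp only [mem_iUnion, mem_inter_iff, mem_ofPred_eq]
        exact ⟨fun ⟨_, h, _⟩ => h, fun h => ⟨x k, h, le_rfl⟩⟩
      obtain ⟨m, hm⟩ := hc (fun m => S ∩ {x | x k ≤ m})
        (fun m m' h x hx => ⟨hx.1, le_trans hx.2 h⟩) a (by rwa [hU])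
      exact ⟨m, fun _ => hm⟩
    · exact ⟨0, fun h => absurd h hS⟩
  choose m hm using step
  let T : ℕ → Set (ℕ → ℕ) := fun k =>
    Nat.rec univ (fun k S => S ∩ {x | x k ≤ m S k}) k
  have hT : ∀ k, T (k + 1) = T k ∩ {x | x k ≤ m (T k) k} := fun k => rfl
  have hpos : ∀ k, a < c (T k) := by
    intro k
    induction k with
    | zero => exact ha
    | succ k ih => rw [hT]; exact hm _ _ ih
  refine ⟨fun k => m (T k) k, fun k => ?_⟩
  set q : ℕ → ℕ := fun k => m (T k) k with hq
  have heq : boundedPrefix q k = T k := by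
    induction k with
    | zero => ext; simp [boundedPrefix, T]
    | succ k ih =>
      have hT' : T (k + 1) = T k ∩ {x | x k ≤ q k} := hT k
      rw [hT', ← ih]
      ext x
      simp only [boundedPrefix, mem_ofPred_eq, mem_inter_iff, Nat.lt_succ_iff_lt_or_eq]
      constructor
      · exact fun h => ⟨fun i hi => h i (Or.inl hi), h k (Or.inr rfl)⟩
      · rintro ⟨h, h'⟩ i (hi | rfl)
        · exact h i hi
        · exact h'
  rw [heq]
  exact hpos k

variable {X Y : Type*} [TopologicalSpace X] [MeasurableSpace X] [T2Space X] [BorelSpace X]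
  [TopologicalSpace Y] [MeasurableSpace Y] [T2Space Y] [BorelSpace Y]
  {μ : Measure X} {ν : Measure Y} [IsFiniteMeasure μ] [IsFiniteMeasure ν]

/-- Coding by Cantor-valued maps turns `U` into the preimage of a Borel set, which is analytic, and
Lusin makes the coding continuous on a compact rectangle. The sequences bounded by a suitable `n`
then cut out a compact piece of `U`. Its cost stays positive since open strips covering it also
cover the piece of some `boundedPrefix n k`. -/
lemma exists_isCompact_coverCost_pos (hμ : IsRadon μ) (hν : IsRadon ν) {U : Set (X × Y)}
    (hU : MeasurableSet U) (hpos : 0 < coverCost μ ν U) :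
    ∃ Z ⊆ U, IsCompact Z ∧ 0 < coverCost μ ν Z := by
  obtain ⟨f, g, V, hf, hg, hV, rfl⟩ := exists_preimage_cantor hU
  set c₀ := coverCost μ ν (Prod.map f g ⁻¹' V) with hc₀
  have hc₀top : c₀ ≠ ⊤ := coverCost_ne_top _
  -- Each factor may lose a quarter of the cost, so restricting to `K ×ˢ L` loses at most half.
  have h4 : 0 < c₀ / 2 / 2 := ENNReal.half_pos (ENNReal.half_pos hpos.ne').ne'
  obtain ⟨K, hK, hfK, hμK⟩ := hμ.exists_continuousOn hf h4
  obtain ⟨L, hL, hgL, hνL⟩ := hν.exists_continuousOn hg h4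
  have hpos' : 0 < coverCost μ ν (Prod.map f g ⁻¹' V ∩ K ×ˢ L) := by
    by_contra h0
    have h0' := nonpos_iff_eq_zero.1 (not_lt.1 h0)
    have := coverCost_le_inter_prod (μ := μ) (ν := ν) (U := Prod.map f g ⁻¹' V)
      hK.measurableSet hL.measurableSet
    rw [h0', zero_add] at this
    have h5 : c₀ ≤ c₀ / 2 := this.trans ((add_le_add hμK hνL).trans (ENNReal.add_halves _).le)
    exact absurd h5 (ENNReal.half_lt_self hpos.ne' hc₀top).not_ge
  have hne : V.Nonempty := by
    rw [nonempty_iff_ne_empty]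
    rintro rfl
    have : coverCost μ ν (Prod.map f g ⁻¹' ∅ ∩ K ×ˢ L) ≤ μ ∅ + ν ∅ :=
      coverCost_le .empty .empty (by simp)
    simp at this
    simp [this] at hpos'
  have : SecondCountableTopology (ℕ → Bool) := inferInstance
  have : TopologicalSpace.SeparableSpace ((ℕ → Bool) × (ℕ → Bool)) := inferInstance
  have hVan := hV.analyticSet
  rw [AnalyticSet] at hVan
  obtain ⟨h, hh, rfl⟩ := hVan.resolve_left hne.ne_empty
  have hfg : ContinuousOn (Prod.map f g) (K ×ˢ L) := hfK.prodMap hgL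
  have hKL : IsCompact (K ×ˢ L) := hK.prod hL
  obtain ⟨a, ha0, ha⟩ := exists_between hpos'
  let T : Set (ℕ → ℕ) → Set (X × Y) := fun S => Prod.map f g ⁻¹' (h '' S) ∩ K ×ˢ L
  have hTmono : Monotone T := fun S S' hS =>
    inter_subset_inter_left _ (preimage_mono (image_mono hS))
  obtain ⟨n, hn⟩ := exists_boundedPrefix_lt (c := fun S => coverCost μ ν (T S)) (a := a)
    (by
      intro S hS b hb
      refine exists_lt_coverCost_of_iUnion (U := fun n => T (S n))
        (fun i j hij => hTmono (hS hij)) ?_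
      have : T (⋃ n, S n) = ⋃ n, T (S n) := by
        simp only [T, image_iUnion, preimage_iUnion, iUnion_inter]
      rwa [← this])
    (by simpa [T] using ha)
  have hB : IsCompact (h '' {x | ∀ i, x i ≤ n i}) := (isCompact_setOf_le n).image hh
  refine ⟨T {x | ∀ i, x i ≤ n i}, ?_, ?_, ?_⟩
  · exact inter_subset_left.trans (preimage_mono (image_subset_range _ _))
  · have := hfg.preimage_isClosed_of_isClosed hKL.isClosed hB.isClosed
    exact hKL.of_isClosed_subset (by rwa [inter_comm] at this) inter_subset_right
  · by_contra h0
    have hlt : coverCost μ ν (T {x | ∀ i, x i ≤ n i}) < a := (not_lt.1 h0).trans_lt ha0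
    obtain ⟨A, B, hA, hB', hc, hlt⟩ := exists_cover_of_coverCost_lt hlt
    -- Half of the gap for each strip: the open enlargements together still cost at most `a`.
    have hd : 0 < (a - (μ A + ν B)) / 2 := ENNReal.half_pos (tsub_pos_of_lt hlt).ne'
    obtain ⟨A', hAA', hA'o, hA'⟩ := hμ.exists_isOpen hA hd
    obtain ⟨B', hBB', hB'o, hB''⟩ := hν.exists_isOpen hB' hd
    set W : Set (X × Y) := (A' ×ˢ univ) ∪ (univ ×ˢ B') with hW
    have hWo : IsOpen W := (hA'o.prod isOpen_univ).union (isOpen_univ.prod hB'o)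
    -- Avoiding this compact set of codes is an open condition on sequences, and it holds for all
    -- sequences bounded by `n`.
    have hD : IsCompact (Prod.map f g '' (K ×ˢ L \ W)) :=
      (hKL.diff hWo).image_of_continuousOn (hfg.mono sdiff_subset)
    obtain ⟨k, hk⟩ := exists_boundedPrefix_subset n (hD.isClosed.isOpen_compl.preimage hh) (by
      rintro x hx ⟨z, ⟨hz, hzW⟩, hzx⟩
      refine hzW ?_
      rcases hc (⟨⟨x, hx, hzx.symm⟩, hz⟩ : z ∈ T {x | ∀ i, x i ≤ n i}) with h | h
      · exact Or.inl ⟨hAA' h.1, mem_univ _⟩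
      · exact Or.inr ⟨mem_univ _, hBB' h.2⟩)
    have hTk : T (boundedPrefix n k) ⊆ W := by
      rintro z ⟨⟨x, hx, hxz⟩, hz⟩
      by_contra hzW
      exact hk hx ⟨z, ⟨hz, hzW⟩, hxz.symm⟩
    have h6 : coverCost μ ν (T (boundedPrefix n k)) ≤ a :=
      calc _ ≤ μ A' + ν B' := coverCost_le hA'o.measurableSet hB'o.measurableSet hTk
        _ ≤ (μ A + (a - (μ A + ν B)) / 2) + (ν B + (a - (μ A + ν B)) / 2) := add_le_add hA' hB''
        _ = (μ A + ν B) + ((a - (μ A + ν B)) / 2 + (a - (μ A + ν B)) / 2) := by ring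
        _ = a := by rw [ENNReal.add_halves, add_tsub_cancel_of_le hlt.le]
    exact absurd h6 (hn k).not_ge

end Capacitability

/-! ### Duality on compact spaces: measures with dominated marginals. -/

section HahnBanach

/-- A nonnegative sublinear functional dominates a linear functional that agrees with it at a given
point. -/
lemma exists_linear_le_sublinear {E : Type*} [AddCommGroup E] [Module ℝ E] (N : E → ℝ)
    (N_hom : ∀ c : ℝ, 0 < c → ∀ x, N (c • x) = c * N x) (N_add : ∀ x y, N (x + y) ≤ N x + N y)
    (N_nonneg : ∀ x, 0 ≤ N x) {x : E} (hx : x ≠ 0) :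
    ∃ L : E →ₗ[ℝ] ℝ, L x = N x ∧ ∀ y, L y ≤ N y := by
  obtain ⟨L, hL, hLN⟩ := exists_extension_of_le_sublinear
    (LinearPMap.mkSpanSingleton (K := ℝ) x (N x) hx) N N_hom N_add (by
      rintro ⟨y, hy⟩
      obtain ⟨c, rfl⟩ := Submodule.mem_span_singleton.1 hy
      rw [show (LinearPMap.mkSpanSingleton (K := ℝ) x (N x) hx) ⟨c • x, hy⟩ = c * N x from
        LinearPMap.mkSpanSingleton'_apply x (N x) _ c hy]
      rcases lt_trichotomy c 0 with hc | rfl | hc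
      · exact (mul_nonpos_of_nonpos_of_nonneg hc.le (N_nonneg x)).trans (N_nonneg _)
      · simpa using N_nonneg _
      · exact (N_hom c hc x).ge)
  refine ⟨L, ?_, hLN⟩
  have h := hL ⟨x, Submodule.mem_span_singleton_self x⟩
  exact h.trans (LinearPMap.mkSpanSingleton_apply ℝ ℝ hx (N x))

open scoped CompactlySupported in
/-- The smallest cost of bounding `φ` from above by a sum of functions of `u z` and `v z`. -/
noncomputable def dualCost {X Y Z : Type*} [MeasurableSpace X] [MeasurableSpace Y]
    [TopologicalSpace Z] (μ : Measure X) (ν : Measure Y) (u : Z → X) (v : Z → Y)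
    (φ : C_c(Z, ℝ)) : ENNReal :=
  ⨅ (f : X → ENNReal) (g : Y → ENNReal) (_ : Measurable f ∧ Measurable g ∧
    ∀ z, ENNReal.ofReal (φ z) ≤ f (u z) + g (v z)), ∫⁻ x, f x ∂μ + ∫⁻ y, g y ∂ν

open scoped CompactlySupported

section DualCost

variable {X Y Z : Type*} [MeasurableSpace X] [MeasurableSpace Y] [TopologicalSpace Z]
  {μ : Measure X} {ν : Measure Y} {u : Z → X} {v : Z → Y}

lemma dualCost_le {φ : C_c(Z, ℝ)} {f : X → ENNReal} {g : Y → ENNReal} (hf : Measurable f)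
    (hg : Measurable g) (h : ∀ z, ENNReal.ofReal (φ z) ≤ f (u z) + g (v z)) :
    dualCost μ ν u v φ ≤ ∫⁻ x, f x ∂μ + ∫⁻ y, g y ∂ν :=
  iInf₂_le_of_le f g (iInf_le_of_le ⟨hf, hg, h⟩ le_rfl)

lemma dualCost_ne_top [CompactSpace Z] [IsFiniteMeasure μ] [IsFiniteMeasure ν] (φ : C_c(Z, ℝ)) :
    dualCost μ ν u v φ ≠ ⊤ := by
  obtain ⟨C, hC⟩ := (isCompact_range φ.continuous).bddAbove
  have : dualCost μ ν u v φ ≤ ∫⁻ _, ENNReal.ofReal C ∂μ + ∫⁻ _, 0 ∂ν :=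
    dualCost_le measurable_const measurable_const fun z => by
      rw [add_zero]; exact ENNReal.ofReal_le_ofReal (hC (mem_range_self z))
  refine ne_top_of_le_ne_top ?_ this
  simp only [lintegral_const, zero_mul, add_zero]
  finiteness

lemma dualCost_add_le (φ ψ : C_c(Z, ℝ)) :
    dualCost μ ν u v (φ + ψ) ≤ dualCost μ ν u v φ + dualCost μ ν u v ψ := by
  conv_rhs => rw [dualCost, dualCost]
  simp only [ENNReal.iInf_add, ENNReal.add_iInf]
  refine le_iInf₂ fun f g => le_iInf fun hfg => le_iInf₂ fun f' g' => le_iInf fun hfg' => ?_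
  refine (dualCost_le (hfg.1.add hfg'.1) (hfg.2.1.add hfg'.2.1) fun z => ?_).trans_eq ?_
  · calc ENNReal.ofReal ((φ + ψ) z) ≤ ENNReal.ofReal (φ z) + ENNReal.ofReal (ψ z) :=
          ENNReal.ofReal_add_le
      _ ≤ (f' (u z) + g' (v z)) + (f (u z) + g (v z)) :=
        add_le_add (hfg'.2.2 z) (hfg.2.2 z)
      _ = _ := by simp only [Pi.add_apply]; ring
  · simp only [Pi.add_apply]
    rw [lintegral_add_left hfg.1, lintegral_add_left hfg.2.1]
    ring

lemma dualCost_smul_le {c : ℝ} (hc : 0 < c) (φ : C_c(Z, ℝ)) :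
    dualCost μ ν u v (c • φ) ≤ ENNReal.ofReal c * dualCost μ ν u v φ := by
  conv_rhs => rw [dualCost]
  have hc0 : ENNReal.ofReal c ≠ 0 := by simpa using hc
  simp only [ENNReal.mul_iInf_of_ne hc0 ENNReal.ofReal_ne_top]
  refine le_iInf₂ fun f g => le_iInf fun hfg => ?_
  refine (dualCost_le (hfg.1.const_mul (ENNReal.ofReal c)) (hfg.2.1.const_mul (ENNReal.ofReal c))
    fun z => ?_).trans_eq ?_
  · rw [← mul_add, CompactlySupportedContinuousMap.smul_apply, smul_eq_mul,
      ENNReal.ofReal_mul hc.le]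
    gcongr
    exact hfg.2.2 z
  · rw [lintegral_const_mul _ hfg.1, lintegral_const_mul _ hfg.2.1, mul_add]

lemma dualCost_smul {c : ℝ} (hc : 0 < c) (φ : C_c(Z, ℝ)) :
    dualCost μ ν u v (c • φ) = ENNReal.ofReal c * dualCost μ ν u v φ := by
  refine le_antisymm (dualCost_smul_le hc φ) ?_
  have h := dualCost_smul_le (μ := μ) (ν := ν) (u := u) (v := v) (inv_pos.2 hc) (c • φ)
  rw [smul_smul, inv_mul_cancel₀ hc.ne', one_smul] at h
  calc _ ≤ ENNReal.ofReal c * (ENNReal.ofReal c⁻¹ * dualCost μ ν u v (c • φ)) := by gcongr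
    _ = _ := by
      rw [← mul_assoc, ← ENNReal.ofReal_mul hc.le, mul_inv_cancel₀ hc.ne', ENNReal.ofReal_one,
        one_mul]

end DualCost

variable {X Y Z : Type*} [TopologicalSpace X] [MeasurableSpace X] [T2Space X] [BorelSpace X]
  [TopologicalSpace Y] [MeasurableSpace Y] [T2Space Y] [BorelSpace Y]
  {μ : Measure X} {ν : Measure Y} [IsFiniteMeasure μ] [IsFiniteMeasure ν]
  [TopologicalSpace Z] [CompactSpace Z] [T2Space Z] [MeasurableSpace Z] [BorelSpace Z]

/-- Outer regularity of `μ` replaces `A` by an open set, and inner regularity of `ρ` replaces its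
open preimage by compact subsets. -/
lemma measure_preimage_le_of_isOpen {Z : Type*} [TopologicalSpace Z] [MeasurableSpace Z]
    {ρ : Measure Z} [ρ.Regular]
    (hμ : IsRadon μ) {u : Z → X} (hu : Continuous u)
    (h : ∀ (D : Set Z) (V : Set X), IsCompact D → IsOpen V → D ⊆ u ⁻¹' V → ρ D ≤ μ V)
    {A : Set X} (hA : MeasurableSet A) : ρ (u ⁻¹' A) ≤ μ A := by
  refine ENNReal.le_of_forall_pos_le_add fun ε hε _ => ?_
  obtain ⟨V, hAV, hV, hle⟩ := hμ.exists_isOpen hA (ENNReal.coe_pos.2 hε)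
  refine le_trans ?_ hle
  refine (measure_mono (preimage_mono hAV)).trans ?_
  rw [(hV.preimage hu).measure_eq_iSup_isCompact]
  exact iSup₂_le fun D hD => iSup_le fun hDc => h D V hDc hV hD

/-- If the cost of covering the image of a compact space `Z` by strips is positive, then
`Z` carries a nonzero measure whose images are dominated by `μ` and `ν`. -/
lemma exists_measure_of_coverCost_pos (hμ : IsRadon μ) (hν : IsRadon ν) {u : Z → X} {v : Z → Y}
    (hu : Continuous u) (hv : Continuous v)
    (hpos : 0 < coverCost μ ν (range fun z => (u z, v z))) :
    ∃ ρ : Measure Z, IsFiniteMeasure ρ ∧ ρ univ ≠ 0 ∧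
      (∀ A, MeasurableSet A → ρ (u ⁻¹' A) ≤ μ A) ∧
      (∀ B, MeasurableSet B → ρ (v ⁻¹' B) ≤ ν B) := by
  have hZ : Nonempty Z := by
    by_contra hZ
    replace hZ := not_nonempty_iff.1 hZ
    have : coverCost μ ν (range fun z : Z => (u z, v z)) ≤ μ ∅ + ν ∅ :=
      coverCost_le .empty .empty (by simp [range_eq_empty])
    simp at this
    simp [this] at hpos
  set o : C_c(Z, ℝ) := ⟨1, HasCompactSupport.of_compactSpace 1⟩ with ho
  have ho1 : ∀ z, o z = 1 := fun z => rfl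
  have hoz : o ≠ 0 := fun h => by
    obtain ⟨z⟩ := hZ
    have := DFunLike.congr_fun h z
    rw [ho1] at this
    simp at this
  have hone : 0 < dualCost μ ν u v o := by
    refine lt_of_lt_of_le (ENNReal.half_pos hpos.ne') ?_
    refine le_iInf₂ fun f g => le_iInf fun ⟨hf, hg, hfg⟩ => ?_
    have h2 : coverCost μ ν (range fun z => (u z, v z)) ≤ μ {x | 2⁻¹ ≤ f x} + ν {y | 2⁻¹ ≤ g y} := by
      refine coverCost_le (measurableSet_le measurable_const hf)
        (measurableSet_le measurable_const hg) ?_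
      rintro _ ⟨z, rfl⟩
      by_contra hz
      simp only [mem_union, mem_prod, mem_ofPred_eq, mem_univ, and_true, true_and, not_or,
        not_le] at hz
      have := hfg z
      rw [ho1, ENNReal.ofReal_one] at this
      have h3 := this.trans_lt (ENNReal.add_lt_add hz.1 hz.2)
      rw [ENNReal.inv_two_add_inv_two] at h3
      exact lt_irrefl _ h3
    have h3 := mul_meas_ge_le_lintegral (μ := μ) hf 2⁻¹
    have h4 := mul_meas_ge_le_lintegral (μ := ν) hg 2⁻¹
    rw [ENNReal.div_eq_inv_mul]
    calc _ ≤ 2⁻¹ * (μ {x | 2⁻¹ ≤ f x} + ν {y | 2⁻¹ ≤ g y}) := by gcongr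
      _ ≤ _ := by rw [mul_add]; exact add_le_add h3 h4
  have hfin : ∀ φ, dualCost μ ν u v φ ≠ ⊤ := dualCost_ne_top
  obtain ⟨L, hLo, hL⟩ := exists_linear_le_sublinear (fun φ => (dualCost μ ν u v φ).toReal)
    (fun c hc φ => by rw [dualCost_smul hc, ENNReal.toReal_mul, ENNReal.toReal_ofReal hc.le])
    (fun φ ψ => by
      rw [← ENNReal.toReal_add (hfin φ) (hfin ψ)]
      exact ENNReal.toReal_mono (ENNReal.add_ne_top.2 ⟨hfin φ, hfin ψ⟩) (dualCost_add_le φ ψ))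
    (fun φ => ENNReal.toReal_nonneg) hoz
  -- Nonpositive functions have dual cost zero, so domination by `dualCost` already forces `L` to be
  -- positive.
  have hLpos : ∀ φ : C_c(Z, ℝ), 0 ≤ φ → 0 ≤ L φ := by
    intro φ hφ
    have h0 : dualCost μ ν u v (-φ) = 0 := by
      have : dualCost μ ν u v (-φ) ≤ ∫⁻ _, 0 ∂μ + ∫⁻ _, 0 ∂ν :=
        dualCost_le measurable_const measurable_const fun z => by
          have hz : 0 ≤ φ z := hφ z
          simp [hz]
      simpa using this
    have := hL (-φ)
    simp only [h0, map_neg, ENNReal.toReal_zero] at this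
    linarith
  have hLle : ∀ φ, ENNReal.ofReal (L φ) ≤ dualCost μ ν u v φ := fun φ =>
    ENNReal.ofReal_le_of_le_toReal (hL φ)
  let Λ : C_c(Z, ℝ) →ₚ[ℝ] ℝ := PositiveLinearMap.mk₀ L hLpos
  have hΛ : ∀ φ, Λ φ = L φ := fun _ => rfl
  -- A Urysohn function compares the measure of `D` with `L`. When `W` is the preimage of an open
  -- `V`, the indicator of `V` alone is an admissible competitor in `dualCost`.
  have hkey : ∀ D W : Set Z, IsCompact D → IsOpen W → D ⊆ W → ∃ φ : C_c(Z, ℝ),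
      (∀ z, ENNReal.ofReal (φ z) ≤ W.indicator 1 z) ∧ RealRMK.rieszMeasure Λ D ≤
        ENNReal.ofReal (L φ) := by
    intro D W hD hW hDW
    obtain ⟨φ, h1, h0, hφc, hφ⟩ := exists_continuous_one_zero_of_isCompact hD hW.isClosed_compl
      (disjoint_compl_right_iff_subset.2 hDW)
    refine ⟨⟨φ, hφc⟩, fun z => ?_, ?_⟩
    · by_cases hz : z ∈ W
      · simpa [hz] using (hφ z).2
      · have : φ z = 0 := h0 hz
        simp [hz, this]
    · exact RealRMK.rieszMeasure_le_of_eq_one Λ (fun z => (hφ z).1) hD h1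
  refine ⟨RealRMK.rieszMeasure Λ, inferInstance, ?_, ?_, ?_⟩
  · intro h0
    have hi := RealRMK.integral_rieszMeasure Λ o
    rw [Measure.measure_univ_eq_zero.1 h0, integral_zero_measure, hΛ, hLo] at hi
    exact (ENNReal.toReal_pos hone.ne' (hfin o)).ne hi
  · refine fun A hA => measure_preimage_le_of_isOpen hμ hu (fun D V hD hV hDV => ?_) hA
    obtain ⟨φ, hφ, hle⟩ := hkey D _ hD (hV.preimage hu) hDV
    refine hle.trans ((hLle φ).trans ?_)
    refine (dualCost_le (f := V.indicator 1) (g := fun _ => 0)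
      (measurable_one.indicator hV.measurableSet) measurable_const fun z => ?_).trans_eq ?_
    · rw [add_zero]; exact hφ z
    · simp [lintegral_indicator_one hV.measurableSet]
  · refine fun A hA => measure_preimage_le_of_isOpen hν hv (fun D V hD hV hDV => ?_) hA
    obtain ⟨φ, hφ, hle⟩ := hkey D _ hD (hV.preimage hv) hDV
    refine hle.trans ((hLle φ).trans ?_)
    refine (dualCost_le (f := fun _ => 0) (g := V.indicator 1) measurable_const
      (measurable_one.indicator hV.measurableSet) fun z => ?_).trans_eq ?_
    · rw [zero_add]; exact hφ z
    · simp [lintegral_indicator_one hV.measurableSet]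

end HahnBanach

/-! ### Extension to couplings, null sets of all couplings, and the Radon property. -/

section Coupling

/-- A measure whose marginals are dominated by `μ` and `ν` is dominated by a coupling. -/
lemma exists_coupling_ge {X Y : Type*} [MeasurableSpace X] [MeasurableSpace Y] {μ : Measure X}
    {ν : Measure Y} [IsProbabilityMeasure μ] [IsProbabilityMeasure ν] {π₀ : Measure (X × Y)}
    (h₁ : π₀.map Prod.fst ≤ μ) (h₂ : π₀.map Prod.snd ≤ ν) :
    ∃ π : Measure (X × Y), π.map Prod.fst = μ ∧ π.map Prod.snd = ν ∧ π₀ ≤ π := by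
  have hm₁ : π₀.map Prod.fst univ = π₀ univ := by
    rw [Measure.map_apply measurable_fst .univ, preimage_univ]
  have hm₂ : π₀.map Prod.snd univ = π₀ univ := by
    rw [Measure.map_apply measurable_snd .univ, preimage_univ]
  have : IsFiniteMeasure π₀ := ⟨by
    rw [← hm₁]; exact (h₁ univ).trans_lt (measure_lt_top _ _)⟩
  set μ' := μ - π₀.map Prod.fst with hμ'
  set ν' := ν - π₀.map Prod.snd with hν'
  have e₁ : μ' univ = 1 - π₀ univ := by
    rw [hμ', Measure.sub_apply .univ h₁, hm₁, measure_univ]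
  have e₂ : ν' univ = 1 - π₀ univ := by
    rw [hν', Measure.sub_apply .univ h₂, hm₂, measure_univ]
  have hfin : (1 - π₀ univ : ENNReal) ≠ ⊤ := by finiteness
  -- The missing marginals have equal mass, so their normalised product fills the gap. If that mass
  -- is zero the factor is `⊤`, but both missing marginals vanish.
  refine ⟨π₀ + (1 - π₀ univ)⁻¹ • μ'.prod ν', ?_, ?_, Measure.le_add_right le_rfl⟩
  · rw [Measure.map_add _ _ measurable_fst, Measure.map_smul, Measure.map_fst_prod, e₂, smul_smul]
    rcases eq_or_ne (1 - π₀ univ) 0 with h0 | h0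
    · have : μ' = 0 := Measure.measure_univ_eq_zero.1 (e₁.trans h0)
      rw [this, smul_zero, add_zero]
      rw [← Measure.sub_add_cancel_of_le h₁, ← hμ', this, zero_add]
    · rw [ENNReal.inv_mul_cancel h0 hfin, one_smul, add_comm, Measure.sub_add_cancel_of_le h₁]
  · rw [Measure.map_add _ _ measurable_snd, Measure.map_smul, Measure.map_snd_prod, e₁, smul_smul]
    rcases eq_or_ne (1 - π₀ univ) 0 with h0 | h0
    · have : ν' = 0 := Measure.measure_univ_eq_zero.1 (e₂.trans h0)
      rw [this, smul_zero, add_zero]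
      rw [← Measure.sub_add_cancel_of_le h₂, ← hν', this, zero_add]
    · rw [ENNReal.inv_mul_cancel h0 hfin, one_smul, add_comm, Measure.sub_add_cancel_of_le h₂]

variable {X Y : Type*} [TopologicalSpace X] [MeasurableSpace X] [T2Space X] [BorelSpace X]
  [TopologicalSpace Y] [MeasurableSpace Y] [T2Space Y] [BorelSpace Y]
  {μ : Measure X} {ν : Measure Y}

/-- A measurable set that is null for all couplings is covered by two null strips. -/
lemma exists_null_cover_of_forall_coupling [IsProbabilityMeasure μ] [IsProbabilityMeasure ν]
    (hμ : IsRadon μ) (hν : IsRadon ν) {U : Set (X × Y)} (hU : MeasurableSet U)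
    (h : ∀ π : Measure (X × Y), π.map Prod.fst = μ → π.map Prod.snd = ν → π U = 0) :
    ∃ A B, MeasurableSet A ∧ MeasurableSet B ∧ μ A = 0 ∧ ν B = 0 ∧
      U ⊆ (A ×ˢ univ) ∪ (univ ×ˢ B) := by
  refine exists_null_cover ?_
  by_contra hne
  obtain ⟨Z, hZU, hZ, hpos⟩ := exists_isCompact_coverCost_pos hμ hν hU (pos_iff_ne_zero.2 hne)
  have : CompactSpace Z := isCompact_iff_compactSpace.1 hZ
  -- The Riesz measure needs the Borel σ-algebra of `Z`, which may exceed the trace of the product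
  -- σ-algebra. The pushforward below returns to the latter.
  let _ : MeasurableSpace Z := borel Z
  have : BorelSpace Z := ⟨rfl⟩
  have hu : Continuous fun z : Z => z.1.1 := continuous_fst.comp continuous_subtype_val
  have hv : Continuous fun z : Z => z.1.2 := continuous_snd.comp continuous_subtype_val
  obtain ⟨ρ, hρ, hρ0, hρμ, hρν⟩ := exists_measure_of_coverCost_pos hμ hν hu hv
    (by simpa using hpos)
  have hval : Measurable fun z : Z => (z.1.1, z.1.2) := hu.measurable.prodMk hv.measurable
  obtain ⟨π, hπ₁, hπ₂, hle⟩ := exists_coupling_ge (μ := μ) (ν := ν)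
    (π₀ := ρ.map fun z : Z => (z.1.1, z.1.2))
    (by
      rw [Measure.map_map measurable_fst hval, Measure.le_iff]
      intro A hA
      rw [Measure.map_apply (measurable_fst.comp hval) hA]
      exact hρμ A hA)
    (by
      rw [Measure.map_map measurable_snd hval, Measure.le_iff]
      intro A hA
      rw [Measure.map_apply (measurable_snd.comp hval) hA]
      exact hρν A hA)
  have h0 := nonpos_iff_eq_zero.1 ((hle U).trans (h π hπ₁ hπ₂).le)
  rw [Measure.map_apply hval hU] at h0
  refine hρ0 ?_
  rwa [show (fun z : Z => (z.1.1, z.1.2)) ⁻¹' U = univ from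
    eq_univ_of_forall fun z => hZU z.2] at h0

/-- Measurable sets that are approximated from inside by measurable compact sets. -/
def IsInnerCompact {X : Type*} [TopologicalSpace X] [MeasurableSpace X] (m : Measure X)
    (B : Set X) : Prop :=
  ∀ ε : ENNReal, 0 < ε → ∃ K ⊆ B, IsCompact K ∧ MeasurableSet K ∧ m (B \ K) < ε

lemma IsInnerCompact.iUnion {X : Type*} [TopologicalSpace X] [MeasurableSpace X] {m : Measure X}
    [IsFiniteMeasure m] {B : ℕ → Set X} (hB : ∀ n, MeasurableSet (B n))
    (h : ∀ n, IsInnerCompact m (B n)) : IsInnerCompact m (⋃ n, B n) := by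
  intro ε hε
  have hε2 := ENNReal.half_pos hε.ne'
  obtain ⟨e, he0, hes⟩ := ENNReal.exists_pos_sum_of_countable' hε2.ne' ℕ
  choose K hKB hK hKm hlt using fun n => h n (e n) (he0 n)
  have h1 : m ((⋃ n, B n) \ ⋃ n, K n) < ε / 2 :=
    calc _ ≤ m (⋃ n, B n \ K n) := measure_mono fun x hx => by
          obtain ⟨n, hn⟩ := mem_iUnion.1 hx.1
          exact mem_iUnion.2 ⟨n, hn, fun h => hx.2 (mem_iUnion.2 ⟨n, h⟩)⟩
      _ ≤ ∑' n, m (B n \ K n) := measure_iUnion_le _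
      _ ≤ ∑' n, e n := ENNReal.tsum_le_tsum fun n => (hlt n).le
      _ < ε / 2 := hes
  -- Finitely many `K n` suffice, by continuity from above. This is where the compact sets have to
  -- be measurable, which is not automatic in the product σ-algebra.
  have hlim : Filter.Tendsto (fun N => m ((⋃ n, B n) \ accumulate K N)) Filter.atTop
      (nhds (m (⋂ N, ((⋃ n, B n) \ accumulate K N)))) := by
    refine tendsto_measure_iInter_atTop (fun N => ?_) ?_ ⟨0, by finiteness⟩
    · exact ((MeasurableSet.iUnion hB).diff
        (.biUnion (to_countable _) fun i _ => hKm i)).nullMeasurableSet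
    · exact fun i j hij => sdiff_subset_sdiff_right (monotone_accumulate hij)
  rw [← sdiff_iUnion, iUnion_accumulate] at hlim
  obtain ⟨N, hN⟩ := (hlim.eventually_lt_const (h1.trans_le ENNReal.half_le_self)).exists
  refine ⟨accumulate K N, ?_, ?_, .biUnion (to_countable _) fun i _ => hKm i, hN⟩
  · exact iUnion₂_subset fun i _ => (hKB i).trans (subset_iUnion B i)
  · exact (finite_Iic N).isCompact_biUnion fun i _ => hK i

lemma IsInnerCompact.iInter {X : Type*} [TopologicalSpace X] [MeasurableSpace X] [T2Space X]
    {m : Measure X} {B : ℕ → Set X}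
    (h : ∀ n, IsInnerCompact m (B n)) : IsInnerCompact m (⋂ n, B n) := by
  intro ε hε
  obtain ⟨e, he0, hes⟩ := ENNReal.exists_pos_sum_of_countable' hε.ne' ℕ
  choose K hKB hK hKm hlt using fun n => h n (e n) (he0 n)
  refine ⟨⋂ n, K n, iInter_mono hKB, ?_, .iInter hKm, ?_⟩
  · exact (hK 0).of_isClosed_subset (isClosed_iInter fun n => (hK n).isClosed) (iInter_subset _ 0)
  · calc _ ≤ m (⋃ n, B n \ K n) := measure_mono fun x hx => by
          obtain ⟨n, hn⟩ := not_forall.1 fun h => hx.2 (mem_iInter.2 h)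
          exact mem_iUnion.2 ⟨n, mem_iInter.1 hx.1 n, hn⟩
      _ ≤ ∑' n, m (B n \ K n) := measure_iUnion_le _
      _ ≤ ∑' n, e n := ENNReal.tsum_le_tsum fun n => (hlt n).le
      _ < ε := hes

lemma IsInnerCompact.union {X : Type*} [TopologicalSpace X] [MeasurableSpace X] {m : Measure X}
    [IsFiniteMeasure m] {B C : Set X} (hB : MeasurableSet B) (hC : MeasurableSet C)
    (h : IsInnerCompact m B) (h' : IsInnerCompact m C) : IsInnerCompact m (B ∪ C) := by
  have : B ∪ C = ⋃ n : ℕ, if n = 0 then B else C := by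
    ext x
    simp only [mem_union, mem_iUnion]
    constructor
    · rintro (h | h)
      · exact ⟨0, h⟩
      · exact ⟨1, h⟩
    · rintro ⟨n, hn⟩
      split_ifs at hn
      · exact Or.inl hn
      · exact Or.inr hn
  rw [this]
  exact .iUnion (fun n => by split_ifs <;> assumption) (fun n => by split_ifs <;> assumption)

/-- Couplings of Radon measures are Radon. -/
lemma isRadon_of_map_eq (hμ : IsRadon μ) (hν : IsRadon ν) {π : Measure (X × Y)}
    [IsFiniteMeasure π] (h₁ : π.map Prod.fst = μ) (h₂ : π.map Prod.snd = ν) : IsRadon π := by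
  have hrect : ∀ s t, MeasurableSet s → MeasurableSet t → IsInnerCompact π (s ×ˢ t) := by
    intro s t hs ht ε hε
    have hε2 := ENNReal.half_pos hε.ne'
    obtain ⟨K, hKs, hK, hltK⟩ := hμ s hs _ hε2
    obtain ⟨L, hLt, hL, hltL⟩ := hν t ht _ hε2
    refine ⟨K ×ˢ L, prod_mono hKs hLt, hK.prod hL, hK.measurableSet.prod hL.measurableSet, ?_⟩
    rw [← h₁, Measure.map_apply measurable_fst (hs.diff hK.measurableSet)] at hltK
    rw [← h₂, Measure.map_apply measurable_snd (ht.diff hL.measurableSet)] at hltL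
    calc _ ≤ π (Prod.fst ⁻¹' (s \ K) ∪ Prod.snd ⁻¹' (t \ L)) := measure_mono fun z hz => by
          by_cases hzK : z.1 ∈ K
          · exact Or.inr ⟨hz.1.2, fun hzL => hz.2 ⟨hzK, hzL⟩⟩
          · exact Or.inl ⟨hz.1.1, hzK⟩
      _ ≤ _ := measure_union_le _ _
      _ < ε / 2 + ε / 2 := ENNReal.add_lt_add hltK hltL
      _ = ε := ENNReal.add_halves ε
  -- Asking for `B` and `Bᶜ` together makes the property stable under complements, so induction from
  -- rectangles applies.
  have key : ∀ B : Set (X × Y), MeasurableSet B → IsInnerCompact π B ∧ IsInnerCompact π Bᶜ := by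
    intro B hB
    have hB' := hB
    rw [← generateFrom_prod] at hB'
    induction B, hB' using MeasurableSpace.generateFrom_induction with
    | hC B hmem _ =>
      obtain ⟨s, hs, t, ht, rfl⟩ := hmem
      refine ⟨hrect s t hs ht, ?_⟩
      rw [compl_prod_eq_union]
      exact .union (hs.compl.prod .univ) (MeasurableSet.univ.prod ht.compl)
        (hrect _ _ hs.compl .univ) (hrect _ _ .univ ht.compl)
    | empty =>
      refine ⟨fun ε hε => ⟨∅, Subset.rfl, isCompact_empty, .empty, by simpa using hε⟩, ?_⟩
      rw [compl_empty, ← univ_prod_univ]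
      exact hrect _ _ .univ .univ
    | compl B _ ih =>
      rw [compl_compl]
      exact (ih (by simpa using hB.compl)).symm
    | iUnion B hB' ih =>
      replace hB' : ∀ n, MeasurableSet (B n) := fun n => by
        have := hB' n; rwa [generateFrom_prod] at this
      refine ⟨.iUnion hB' fun n => (ih n (hB' n)).1, ?_⟩
      rw [compl_iUnion]
      exact .iInter fun n => (ih n (hB' n)).2
  intro B hB ε hε
  obtain ⟨K, hKB, hK, -, hlt⟩ := (key B hB).1 ε hε
  exact ⟨K, hKB, hK, hlt⟩

end Coupling

/-! ### Mixtures of transports and the supports of their disintegrations. -/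

section Transport

variable {Ω : Type*} [TopologicalSpace Ω] [MeasurableSpace Ω] [BorelSpace Ω]
  {G : Set (Ω → ℝ)} {p : Ω → ℝ} {μ ν : Measure Ω}

omit [MeasurableSpace Ω] [BorelSpace Ω] in
lemma StandingAssumption.continuous (hG : StandingAssumption G p) {g : Ω → ℝ} (hg : g ∈ G) :
    Continuous g := by
  rw [continuous_iff_le_induced]
  exact hG.topology_eq.le.trans (iInf₂_le g hg)

omit [MeasurableSpace Ω] [BorelSpace Ω] in
lemma StandingAssumption.t2Space (hG : StandingAssumption G p) : T2Space Ω :=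
  ⟨fun x y hxy => by
    obtain ⟨g, hg, hne⟩ := hG.separates x y hxy
    exact separated_by_continuous (hG.continuous hg) hne⟩

omit [MeasurableSpace Ω] [BorelSpace Ω] in
lemma StandingAssumption.abs_le_growthNorm (hG : StandingAssumption G p) {g : Ω → ℝ}
    (hg : g ∈ G) (ω : Ω) : |g ω| ≤ growthNorm (fun ω => p ω + 1) g * (p ω + 1) := by
  have hp : ∀ ω, 0 < p ω + 1 := fun ω => by linarith [hG.p_nonneg ω]
  obtain ⟨C, -, hC⟩ := hG.growth g hg
  rw [← div_le_iff₀ (hp ω)]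
  exact le_ciSup (f := fun ω => |g ω| / (p ω + 1))
    ⟨C, by rintro _ ⟨x, rfl⟩; exact (div_le_iff₀ (hp x)).2 (hC x)⟩ ω

omit [TopologicalSpace Ω] [MeasurableSpace Ω] [BorelSpace Ω] in
lemma le_growthNorm_one {h : Ω → ℝ} (h0 : ∀ ω, 0 ≤ h ω) (hM : ∃ M, ∀ ω, h ω ≤ M) (ω : Ω) :
    h ω ≤ growthNorm (fun _ => 1) h := by
  obtain ⟨M, hM⟩ := hM
  have := le_ciSup (f := fun ω => |h ω| / 1)
    ⟨M, by rintro _ ⟨x, rfl⟩; simpa [abs_of_nonneg (h0 x)] using hM x⟩ ω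
  simpa [growthNorm, abs_of_nonneg (h0 ω)] using this

omit [TopologicalSpace Ω] [MeasurableSpace Ω] [BorelSpace Ω] in
lemma growthNorm_nonneg {w : Ω → ℝ} (hw : ∀ ω, 0 ≤ w ω) (a : Ω → ℝ) : 0 ≤ growthNorm w a :=
  Real.iSup_nonneg fun ω => div_nonneg (abs_nonneg _) (hw ω)

/-- The dominating function depends on the second coordinate only, so the bound is the same for all
measures with second marginal `ν`. -/
lemma integrable_mul_of_map_snd (hG : StandingAssumption G p) (hpν : Integrable p ν)
    [IsFiniteMeasure ν] {π : Measure (Ω × Ω)} (h₂ : π.map Prod.snd = ν) {g h : Ω → ℝ}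
    (hg : g ∈ G) (hh : Measurable h) (h0 : ∀ ω, 0 ≤ h ω) (hM : ∃ M, ∀ ω, h ω ≤ M) :
    Integrable (fun z => g z.2 * h z.1) π ∧ |∫ z, g z.2 * h z.1 ∂π| ≤
      growthNorm (fun _ => 1) h * growthNorm (fun ω => p ω + 1) g * ∫ ω, (p ω + 1) ∂ν := by
  have hp1 : Integrable (fun ω => p ω + 1) ν := hpν.add (integrable_const 1)
  set H := growthNorm (fun _ => 1) h
  set n := growthNorm (fun ω => p ω + 1) g
  have hdom : Integrable (fun z : Ω × Ω => H * n * (p z.2 + 1)) π := by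
    rw [← h₂] at hp1
    exact (hp1.comp_measurable measurable_snd).const_mul _
  have hbound : ∀ z : Ω × Ω, ‖g z.2 * h z.1‖ ≤ H * n * (p z.2 + 1) := fun z => by
    rw [norm_mul, Real.norm_eq_abs, Real.norm_eq_abs, abs_of_nonneg (h0 _)]
    calc _ ≤ (n * (p z.2 + 1)) * H :=
          mul_le_mul (hG.abs_le_growthNorm hg _) (le_growthNorm_one h0 hM _) (h0 _)
            ((abs_nonneg _).trans (hG.abs_le_growthNorm hg _))
      _ = _ := by ring
  have hmeas : Measurable fun z : Ω × Ω => g z.2 * h z.1 :=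
    ((hG.continuous hg).measurable.comp measurable_snd).mul (hh.comp measurable_fst)
  refine ⟨hdom.mono' hmeas.aestronglyMeasurable (.of_forall hbound), ?_⟩
  rw [← Real.norm_eq_abs]
  refine (norm_integral_le_of_norm_le hdom (.of_forall hbound)).trans_eq ?_
  rw [integral_const_mul]
  congr 1
  have hae : AEStronglyMeasurable (fun ω => p ω + 1) (π.map Prod.snd) := by
    rw [h₂]; exact hp1.aestronglyMeasurable
  rw [← h₂, integral_map measurable_snd.aemeasurable hae]

lemma integral_mul_le (hG : StandingAssumption G p) (hpμ : Integrable p μ)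
    [IsFiniteMeasure μ] {g h : Ω → ℝ}
    (hg : g ∈ G) (hh : Measurable h) (h0 : ∀ ω, 0 ≤ h ω) (hM : ∃ M, ∀ ω, h ω ≤ M) :
    ∫ ω, g ω * h ω ∂μ ≤
      growthNorm (fun _ => 1) h * growthNorm (fun ω => p ω + 1) g * ∫ ω, (p ω + 1) ∂μ := by
  -- The diagonal coupling of `μ` with itself reduces this to the bound for couplings.
  have hd : Measurable fun ω : Ω => (ω, ω) := measurable_id.prodMk measurable_id
  have h₂ : (μ.map fun ω : Ω => (ω, ω)).map Prod.snd = μ := by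
    rw [Measure.map_map measurable_snd hd]
    exact Measure.map_id
  have := (integrable_mul_of_map_snd hG hpμ h₂ hg hh h0 hM).2
  have hmeas : Measurable fun z : Ω × Ω => g z.2 * h z.1 :=
    ((hG.continuous hg).measurable.comp measurable_snd).mul (hh.comp measurable_fst)
  rw [integral_map hd.aemeasurable hmeas.aestronglyMeasurable] at this
  exact (le_abs_self _).trans this

/-- Mixing an `ε`-approximating transport with a small multiple of an arbitrary coupling gives
a `δ`-approximating transport. -/
lemma exists_mixture_mem_approxTransports [IsProbabilityMeasure μ] [IsProbabilityMeasure ν]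
    (hG : StandingAssumption G p) (hμ : IsRadon μ) (hν : IsRadon ν)
    (hpμ : Integrable p μ) (hpν : Integrable p ν) {ε δ : ℝ} (hε : 0 ≤ ε) (hεδ : ε < δ)
    {π₀ : Measure (Ω × Ω)} (hπ₀ : π₀ ∈ approxTransports G p ε μ ν) :
    ∃ a b : ENNReal, a ≠ ⊤ ∧ b ≠ ⊤ ∧ b ≠ 0 ∧ a + b = 1 ∧
      ∀ π : Measure (Ω × Ω), π.map Prod.fst = μ → π.map Prod.snd = ν →
        a • π₀ + b • π ∈ approxTransports G p δ μ ν := by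
  have := hG.t2Space
  obtain ⟨hπ₀p, hπ₀R, hπ₀₁, hπ₀₂, hπ₀i⟩ := hπ₀
  set M : ℝ := ∫ ω, (p ω + 1) ∂μ + ∫ ω, (p ω + 1) ∂ν with hM
  have hM0 : 0 ≤ M := add_nonneg
    (integral_nonneg fun ω => add_nonneg (hG.p_nonneg ω) zero_le_one)
    (integral_nonneg fun ω => add_nonneg (hG.p_nonneg ω) zero_le_one)
  -- An arbitrary coupling has defect at most `M`, so a weight `t` with `t * M ≤ δ - ε` is
  -- affordable. The `+ 1` in the denominator gives `t < 1` even if `M = 0`.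
  obtain ⟨t, ht0, ht1, htM⟩ : ∃ t : ℝ, 0 < t ∧ t < 1 ∧ (1 - t) * ε + t * M ≤ δ := by
    have hd : 0 < δ - ε + M + 1 := by linarith
    refine ⟨(δ - ε) / (δ - ε + M + 1), div_pos (by linarith) hd,
      (div_lt_one hd).2 (by linarith), ?_⟩
    have ht : 0 ≤ (δ - ε) / (δ - ε + M + 1) := (div_pos (by linarith) hd).le
    have h1 : (δ - ε) / (δ - ε + M + 1) * M ≤ δ - ε := by
      rw [div_mul_eq_mul_div, div_le_iff₀ hd]
      nlinarith
    nlinarith [mul_nonneg ht hε]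
  have hab : ENNReal.ofReal (1 - t) + ENNReal.ofReal t = 1 := by
    rw [← ENNReal.ofReal_add (by linarith) ht0.le]; simp
  refine ⟨ENNReal.ofReal (1 - t), ENNReal.ofReal t, by finiteness, by finiteness,
    by simpa using ht0, hab, fun π h₁ h₂ => ?_⟩
  have hπp : IsProbabilityMeasure π := ⟨by
    have h := congrArg (fun m => m univ) h₁
    simpa [Measure.map_apply measurable_fst] using h⟩
  refine ⟨⟨by simp [hab]⟩, ?_, ?_, ?_, ?_⟩
  · exact (hπ₀R.smul (by finiteness)).add
      ((isRadon_of_map_eq hμ hν h₁ h₂).smul (by finiteness))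
  · rw [Measure.map_add _ _ measurable_fst, Measure.map_smul, Measure.map_smul, hπ₀₁, h₁,
      ← add_smul, hab, one_smul]
  · rw [Measure.map_add _ _ measurable_snd, Measure.map_smul, Measure.map_smul, hπ₀₂, h₂,
      ← add_smul, hab, one_smul]
  · intro g hg h hh h0 hbd
    obtain ⟨hi₀, -⟩ := integrable_mul_of_map_snd hG hpν hπ₀₂ hg hh h0 hbd
    obtain ⟨hi, hle⟩ := integrable_mul_of_map_snd hG hpν h₂ hg hh h0 hbd
    have hleμ := integral_mul_le hG hpμ hg hh h0 hbd
    have hle₀ := hπ₀i g hg h hh h0 hbd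
    rw [integral_add_measure (hi₀.smul_measure (by finiteness)) (hi.smul_measure (by finiteness)),
      integral_smul_measure, integral_smul_measure, ENNReal.toReal_ofReal (by linarith),
      ENNReal.toReal_ofReal ht0.le, smul_eq_mul, smul_eq_mul]
    have hH : 0 ≤ growthNorm (fun _ => 1) h := growthNorm_nonneg (fun _ => zero_le_one) h
    have hn : 0 ≤ growthNorm (fun ω => p ω + 1) g :=
      growthNorm_nonneg (fun ω => add_nonneg (hG.p_nonneg ω) zero_le_one) g
    set H := growthNorm (fun _ => 1) h
    set n := growthNorm (fun ω => p ω + 1) g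
    set I := ∫ ω, g ω * h ω ∂μ
    set J₀ := ∫ z, g z.2 * h z.1 ∂π₀
    set J := ∫ z, g z.2 * h z.1 ∂π
    have hJ : I - J ≤ M * (H * n) := by
      have := neg_abs_le J
      rw [hM, add_mul]
      linarith
    calc I - ((1 - t) * J₀ + t * J) = (1 - t) * (I - J₀) + t * (I - J) := by ring
      _ ≤ (1 - t) * (ε * H * n) + t * (M * (H * n)) :=
        add_le_add (mul_le_mul_of_nonneg_left hle₀ (by linarith))
          (mul_le_mul_of_nonneg_left hJ ht0.le)
      _ = ((1 - t) * ε + t * M) * (H * n) := by ring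
      _ ≤ δ * (H * n) := mul_le_mul_of_nonneg_right htM (mul_nonneg hH hn)
      _ = δ * H * n := by ring

/-- The kernel `ω ↦ a κ(ω) + b ν`. -/
noncomputable def mixtureKernel (a b : ENNReal) (κ : Kernel Ω Ω) (ν : Measure Ω) : Kernel Ω Ω where
  toFun ω := a • κ ω + b • ν
  measurable' := Measure.measurable_of_measurable_coe _ fun s hs => by
    simp only [Measure.add_apply, Measure.smul_apply, smul_eq_mul]
    exact ((κ.measurable_coe hs).const_mul a).add_const _

omit [TopologicalSpace Ω] [BorelSpace Ω] in
lemma mixtureKernel_apply (a b : ENNReal) (κ : Kernel Ω Ω) (ν : Measure Ω) (ω : Ω) :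
    mixtureKernel a b κ ν ω = a • κ ω + b • ν := rfl

omit [BorelSpace Ω] in
lemma IsDisintegration.mixture [IsProbabilityMeasure μ] [IsProbabilityMeasure ν] (hν : IsRadon ν)
    {π : Measure (Ω × Ω)} {κ : Kernel Ω Ω} (h : IsDisintegration μ π κ) {a b : ENNReal}
    (ha : a ≠ ⊤) (hb : b ≠ ⊤) (hab : a + b = 1) :
    IsDisintegration μ (a • π + b • μ.prod ν) (mixtureKernel a b κ ν) := by
  have hκ : IsMarkovKernel κ := ⟨h.isProbabilityMeasure⟩
  refine ⟨fun ω => ⟨?_⟩, fun ω => ?_, fun B hB E hE => ?_⟩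
  · simp [mixtureKernel_apply, hab]
  · exact ((h.isRadon ω).smul ha).add (hν.smul hb)
  · have hm : Measurable fun ω => κ ω {ω' | (ω, ω') ∈ B} := Kernel.measurable_kernel_prodMk_left hB
    have hmν : Measurable fun ω => ν {ω' | (ω, ω') ∈ B} := measurable_measure_prodMk_left hB
    have hprod : (μ.prod ν) (B ∩ Prod.fst ⁻¹' E) = ∫⁻ ω in E, ν {ω' | (ω, ω') ∈ B} ∂μ := by
      rw [← Measure.restrict_apply hB, ← prod_univ, ← Measure.prod_restrict,
        Measure.restrict_univ, Measure.prod_apply hB]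
      rfl
    simp only [mixtureKernel_apply, Measure.add_apply, Measure.smul_apply, smul_eq_mul]
    rw [lintegral_add_left (hm.const_mul a), lintegral_const_mul _ hm,
      lintegral_const_mul _ hmν, h.disintegrates B hB E hE, hprod]

omit [BorelSpace Ω] in
lemma support_subset_support_mixtureKernel {a b : ENNReal} (hb : b ≠ 0) (κ : Kernel Ω Ω)
    (ν : Measure Ω) (ω : Ω) : ν.support ⊆ (mixtureKernel a b κ ν ω).support := by
  refine Measure.AbsolutelyContinuous.support_mono fun s hs => ?_
  rw [mixtureKernel_apply, Measure.add_apply, add_eq_zero, Measure.smul_apply (b) ν,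
    smul_eq_mul, mul_eq_zero] at hs
  exact hs.2.resolve_left hb

/-- Since `ν` is Radon, the complement of its support is `ν`-null. The second marginal of the
transport is `ν`, so almost every `κ ω` gives this open set no mass. -/
lemma ae_support_subset_support (hν : IsRadon ν) {δ : ℝ} {κ : Kernel Ω Ω}
    (hκ : κ ∈ approxDisintegrations G p δ μ ν) : ∀ᵐ ω ∂μ, (κ ω).support ⊆ ν.support := by
  obtain ⟨π, ⟨_, _, _, h₂, _⟩, hd⟩ := hκ
  have hκ : IsMarkovKernel κ := ⟨hd.isProbabilityMeasure⟩
  have hm : MeasurableSet ν.supportᶜ := Measure.isOpen_compl_support.measurableSet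
  have h0 : π (Prod.snd ⁻¹' ν.supportᶜ) = 0 := by
    rw [← Measure.map_apply measurable_snd hm, h₂, hν.measure_compl_support]
  have h1 := hd.disintegrates _ (measurable_snd hm) univ .univ
  have hmeas : Measurable fun ω => κ ω {ω' | (ω, ω') ∈ Prod.snd ⁻¹' ν.supportᶜ} :=
    Kernel.measurable_kernel_prodMk_left (measurable_snd hm)
  rw [preimage_univ, inter_univ, h0, Measure.restrict_univ, eq_comm,
    lintegral_eq_zero_iff hmeas] at h1
  filter_upwards [h1] with ω hω
  exact Measure.support_subset_of_isClosed Measure.isClosed_support hω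

end Transport

end ApproxTransport

theorem mainTheorem3 {Ω : Type*} [TopologicalSpace Ω] [MeasurableSpace Ω] [BorelSpace Ω]
    (G : Set (Ω → ℝ)) (p : Ω → ℝ) (hG : ApproxTransport.StandingAssumption G p)
    (μ ν : Measure Ω) [IsProbabilityMeasure μ] [IsProbabilityMeasure ν]
    (hμ : ApproxTransport.IsRadon μ) (hν : ApproxTransport.IsRadon ν)
    (hpμ : Integrable p μ) (hpν : Integrable p ν)
    (δ : ℝ) (hδ : 0 < δ)
    (hne : ∃ ε : ℝ, 0 ≤ ε ∧ ε < δ ∧ (ApproxTransport.approxDisintegrations G p ε μ ν).Nonempty) :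
    -- maximal disintegrations exist, and the supports of each of them are trivial
    (∃ κ : Kernel Ω Ω, ApproxTransport.IsMaximalDisintegration G p δ μ ν κ) ∧
    (∀ κ : Kernel Ω Ω, ApproxTransport.IsMaximalDisintegration G p δ μ ν κ →
      ∀ᵐ ω ∂μ, (κ ω).support = ν.support) ∧
    -- characterisation of the polar sets
    (∀ U : Set (Ω × Ω), MeasurableSet U →
      (ApproxTransport.IsPolar (ApproxTransport.approxTransports G p δ μ ν) U ↔
        ∃ N₁ N₂ : Set Ω, MeasurableSet N₁ ∧ MeasurableSet N₂ ∧ μ N₁ = 0 ∧ ν N₂ = 0 ∧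
          U ⊆ (N₁ ×ˢ univ) ∪ (univ ×ˢ N₂))) ∧
    -- no nontrivial paving: a family of cells constrains all the transports if and only if
    -- almost every cell contains the whole support of `ν`
    (∀ C : Ω → Set Ω,
      (∀ κ ∈ ApproxTransport.approxDisintegrations G p δ μ ν, ∀ᵐ ω ∂μ, (κ ω).support ⊆ C ω) ↔
        ∀ᵐ ω ∂μ, ν.support ⊆ C ω) := by
  have := hG.t2Space
  obtain ⟨ε, hε, hεδ, κ₀, π₀, hπ₀, hd₀⟩ := hne
  obtain ⟨a, b, ha, hb, hb0, hab, hmix⟩ :=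
    ApproxTransport.exists_mixture_mem_approxTransports hG hμ hν hpμ hpν hε hεδ hπ₀
  set κ := ApproxTransport.mixtureKernel a b κ₀ ν
  have hκ : κ ∈ ApproxTransport.approxDisintegrations G p δ μ ν :=
    ⟨_, hmix (μ.prod ν) (by simp) (by simp), hd₀.mixture hν ha hb hab⟩
  have hsupp : ∀ ω, ν.support ⊆ (κ ω).support :=
    ApproxTransport.support_subset_support_mixtureKernel hb0 κ₀ ν
  refine ⟨⟨κ, hκ, fun κ' hκ' => ?_⟩, fun κ' hκ' => ?_, fun U hU => ⟨fun hpol => ?_, ?_⟩,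
    fun C => ⟨fun hC => ?_, fun hC κ' hκ' => ?_⟩⟩
  · filter_upwards [ApproxTransport.ae_support_subset_support hν hκ'] with ω hω
    exact hω.trans (hsupp ω)
  · filter_upwards [ApproxTransport.ae_support_subset_support hν hκ'.1, hκ'.2 κ hκ] with ω h1 h2
    exact h1.antisymm ((hsupp ω).trans h2)
  · refine ApproxTransport.exists_null_cover_of_forall_coupling hμ hν hU fun π h₁ h₂ => ?_
    -- A set null for the mixture is null for `π`, whose weight `b` is nonzero.
    have h0 := hpol _ (hmix π h₁ h₂)
    rw [Measure.add_apply, add_eq_zero, Measure.smul_apply b, smul_eq_mul, mul_eq_zero] at h0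
    exact h0.2.resolve_left hb0
  · rintro ⟨N₁, N₂, hN₁, hN₂, hμ0, hν0, hsub⟩ π ⟨-, -, h₁, h₂, -⟩
    refine measure_mono_null hsub (measure_union_null ?_ ?_)
    · rw [prod_univ, ← Measure.map_apply measurable_fst hN₁, h₁, hμ0]
    · rw [univ_prod, ← Measure.map_apply measurable_snd hN₂, h₂, hν0]
  · filter_upwards [hC κ hκ] with ω hω
    exact (hsupp ω).trans hω
  · filter_upwards [ApproxTransport.ae_support_subset_support hν hκ', hC] with ω h1 h2
    exact h1.trans h2
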